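/- Let $F:\mathbb{R}^d\to\mathbb{R}^m$ be twice continuously differentiable, with Jacobian $(JF)_x\in\mathbb{R}^{m\times d}$ and coordinatewise Laplacian $\Delta F:\mathbb{R}^d\to\mathbb{R}^m$. For every $\theta'\in\mathbb{R}^m$ with $\int e^{\langle\theta',F(x)\rangle}\,dx<\infty$ (call such $\theta'$ normalizable) let $p_{\theta'}(x)=e^{\langle\theta',F(x)\rangle}/\int e^{\langle\theta',F(y)\rangle}dy$. Let $\Theta\subseteq\mathbb{R}^m$ be a set of normalizable parameters and let $\theta\in\Theta$. Assume that 1. (identifiability) $p_{\theta'}=p_\theta$ implies $\theta'=\theta$, for every normalizable $\theta'$; 2. (decay) for $X\sim p_\theta$, every entry of $(JF)_X$ and every coordinate of $(JF)_X(JF)_X^T\theta+\Delta F(X)$ has a finite second moment. Let $X_0,X_1,\dots$ be i.i.d. with law $p_\theta$, let $\hat{\mathbb{E}}_n$ denote the average over $X_0,\dots,X_{n-1}$, and let $\Sigma_V$ denote the covariance matrix of a random vector $V$. Then the matrix $\mathbb{E}[(JF)_X(JF)_X^T]$ is invertible, the matrix $$\Gamma_{SM}:=\mathbb{E}[(JF)_X(JF)_X^T]^{-1}\,\Sigma_{(JF)_X(JF)_X^T\theta+\Delta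 F(X)}\,\mathbb{E}[(JF)_X(JF)_X^T]^{-1}$$ is positive semidefinite, and the score matching estimator $$\hat\theta_n=-\hat{\mathbb{E}}_n[(JF)_X(JF)_X^T]^{-1}\,\hat{\mathbb{E}}_n[\Delta F]$$ (with an arbitrary fixed convention for the inverse when the empirical matrix is singular, say $0$) satisfies $$\sqrt n\,(\hat\theta_n-\theta)\to N(0,\Gamma_{SM})\quad\text{in distribution as } n\to\infty.$$ If moreover $\theta$ is an interior point of $\Theta$, the same convergence holds for every sequence of random vectors $\hat\theta_n$ such that, almost surely, $\hat\theta_n$ minimizes the empirical score matching loss $\theta'\mapsto\hat{\mathbb{E}}_n\big[\operatorname{Tr}\nabla^2\log p_{\theta'}+\tfrac12\|\nabla\log p_{\theta'}\|^2\big]$ over $\Theta$ whenever a minimizer exists. -/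

import Mathlib

open MeasureTheory ProbabilityTheory Filter Topology
open scoped Matrix InnerProductSpace

noncomputable section

namespace ScoreMatching

/-- Unnormalized density `exp ⟨θ, F(x)⟩` of the exponential family with sufficient statistic `F`. -/
def unnormalizedDensity {d m : ℕ} (F : EuclideanSpace ℝ (Fin d) → EuclideanSpace ℝ (Fin m))
    (θ : EuclideanSpace ℝ (Fin m)) (x : EuclideanSpace ℝ (Fin d)) : ℝ :=
  Real.exp (inner ℝ θ (F x))

/-- The parameters `θ` for which `exp ⟨θ, F⟩` can be normalized to a probability density. -/
def naturalParameters {d m : ℕ} (F : EuclideanSpace ℝ (Fin d) → EuclideanSpace ℝ (Fin m)) :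
    Set (EuclideanSpace ℝ (Fin m)) :=
  {θ | Integrable (unnormalizedDensity F θ) volume}

/-- The density `p_θ(x) = exp ⟨θ, F(x)⟩ / ∫ exp ⟨θ, F(y)⟩ dy`. -/
def density {d m : ℕ} (F : EuclideanSpace ℝ (Fin d) → EuclideanSpace ℝ (Fin m))
    (θ : EuclideanSpace ℝ (Fin m)) (x : EuclideanSpace ℝ (Fin d)) : ℝ :=
  unnormalizedDensity F θ x / ∫ y, unnormalizedDensity F θ y

/-- The distribution with density `p_θ` with respect to Lebesgue measure. -/
def dist {d m : ℕ} (F : EuclideanSpace ℝ (Fin d) → EuclideanSpace ℝ (Fin m))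
    (θ : EuclideanSpace ℝ (Fin m)) : Measure (EuclideanSpace ℝ (Fin d)) :=
  volume.withDensity fun x => ENNReal.ofReal (density F θ x)

/-- The `m × d` Jacobian matrix `(JF)_x`. -/
def jacobian {d m : ℕ} (F : EuclideanSpace ℝ (Fin d) → EuclideanSpace ℝ (Fin m))
    (x : EuclideanSpace ℝ (Fin d)) : Matrix (Fin m) (Fin d) ℝ :=
  Matrix.of fun i j => fderiv ℝ F x (EuclideanSpace.single j 1) i

/-- The Laplacian of `F`, applied coordinatewise. -/
def lap {d m : ℕ} (F : EuclideanSpace ℝ (Fin d) → EuclideanSpace ℝ (Fin m))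
    (x : EuclideanSpace ℝ (Fin d)) : EuclideanSpace ℝ (Fin m) :=
  WithLp.toLp 2 fun i => Laplacian.laplacian (fun y => F y i) x

/-- The `m × m` matrix `(JF)_x (JF)_xᵀ`. -/
def gram {d m : ℕ} (F : EuclideanSpace ℝ (Fin d) → EuclideanSpace ℝ (Fin m))
    (x : EuclideanSpace ℝ (Fin d)) : Matrix (Fin m) (Fin m) ℝ :=
  jacobian F x * (jacobian F x)ᵀ

/-- The vector `(JF)_x (JF)_xᵀ θ + ΔF(x)`. -/
def scoreVec {d m : ℕ} (F : EuclideanSpace ℝ (Fin d) → EuclideanSpace ℝ (Fin m))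
    (θ : EuclideanSpace ℝ (Fin m)) (x : EuclideanSpace ℝ (Fin d)) : EuclideanSpace ℝ (Fin m) :=
  WithLp.toLp 2 (gram F x *ᵥ (θ : Fin m → ℝ)) + lap F x

/-- Entrywise expectation of a matrix-valued function. -/
def expMatrix {E : Type*} [MeasurableSpace E] {m : ℕ} (A : E → Matrix (Fin m) (Fin m) ℝ)
    (P : Measure E) : Matrix (Fin m) (Fin m) ℝ :=
  Matrix.of fun i j => ∫ x, A x i j ∂P

/-- The covariance matrix `Σ_V` of a random vector `V`. -/
def covMatrix {E : Type*} [MeasurableSpace E] {m : ℕ} (V : E → EuclideanSpace ℝ (Fin m))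
    (P : Measure E) : Matrix (Fin m) (Fin m) ℝ :=
  Matrix.of fun i j => cov[fun x => V x i, fun x => V x j; P]

/-- `Γ_SM = E[JF JFᵀ]⁻¹ Σ_{JF JFᵀ θ + ΔF} E[JF JFᵀ]⁻¹`, moments being taken under `p_θ`. -/
def asympCov {d m : ℕ} (F : EuclideanSpace ℝ (Fin d) → EuclideanSpace ℝ (Fin m))
    (θ : EuclideanSpace ℝ (Fin m)) : Matrix (Fin m) (Fin m) ℝ :=
  (expMatrix (gram F) (dist F θ))⁻¹ * covMatrix (scoreVec F θ) (dist F θ) *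
    (expMatrix (gram F) (dist F θ))⁻¹

/-- The closed-form score matching estimator `-(Ê[JF JFᵀ])⁻¹ Ê[ΔF]` computed from the sample
`x 0, …, x (n - 1)`. -/
def closedFormEstimator {d m : ℕ} (F : EuclideanSpace ℝ (Fin d) → EuclideanSpace ℝ (Fin m))
    (n : ℕ) (x : ℕ → EuclideanSpace ℝ (Fin d)) : EuclideanSpace ℝ (Fin m) :=
  WithLp.toLp 2 (-(((n : ℝ)⁻¹ • ∑ k ∈ Finset.range n, gram F (x k))⁻¹ *ᵥ
    (((n : ℝ)⁻¹ • ∑ k ∈ Finset.range n, lap F (x k) : EuclideanSpace ℝ (Fin m)) : Fin m → ℝ)))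

/-- The empirical score matching loss of a density `q` on the sample `x 0, …, x (n - 1)`: the
sample average of `Tr ∇² log q + ‖∇ log q‖² / 2`. -/
def empiricalLoss {d : ℕ} (n : ℕ) (x : ℕ → EuclideanSpace ℝ (Fin d))
    (q : EuclideanSpace ℝ (Fin d) → ℝ) : ℝ :=
  (n : ℝ)⁻¹ * ∑ k ∈ Finset.range n,
    (Laplacian.laplacian (fun y => Real.log (q y)) (x k) +
      ‖gradient (fun y => Real.log (q y)) (x k)‖ ^ 2 / 2)

/-- `t` minimizes the empirical score matching loss of `p_t` over the parameter set `Θ`. -/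
def IsLossMinimizer {d m : ℕ} (F : EuclideanSpace ℝ (Fin d) → EuclideanSpace ℝ (Fin m))
    (Θ : Set (EuclideanSpace ℝ (Fin m))) (n : ℕ) (x : ℕ → EuclideanSpace ℝ (Fin d))
    (t : EuclideanSpace ℝ (Fin m)) : Prop :=
  t ∈ Θ ∧ ∀ s ∈ Θ, empiricalLoss n x (density F t) ≤ empiricalLoss n x (density F s)

end ScoreMatching

end

/-!
The closed-form estimator solves the empirical version `Ê[JF JFᵀ] t + Ê[ΔF] = 0` of a linear
equation whose population version is solved by `θ`. Its error is therefore
`-Ê[JF JFᵀ]⁻¹ Ê[JF JFᵀ θ + ΔF]`, a product of a convergent random matrix and a centered sample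
mean, and the limit is Gaussian by the central limit theorem and Slutsky's theorem
(`tendstoInDistribution_closedFormEstimator`). Three facts make this work.

* `E[JF JFᵀ θ + ΔF] = 0` under `p_θ` (`integral_scoreVec_eq_zero`): the density times the `i`-th
  coordinate of this vector is the divergence of `p_θ ∇F_i`. Field and divergence are both
  integrable by the decay assumption, and then there is no boundary term at infinity
  (`integral_divergence_eq_zero`, by smooth cutoffs).
* `E[JF JFᵀ]` is positive definite (`posDef_expMatrix_gram`): a null vector `t` would make `⟨t, F⟩`
  constant, so that `θ + t` and `θ` have the same density.
* The central limit theorem holds in `ℝᵐ` (`tendstoInDistribution_inv_sqrt_smul_sum`), by reduction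
  of characteristic functions to the one-dimensional theorem.

The empirical score matching loss is a quadratic function of the parameter with Hessian
`Ê[JF JFᵀ]`. Almost surely, this matrix is eventually positive definite and the closed-form
estimator, which converges to `θ`, eventually lies in `Θ` if `θ` is interior; it is then the unique
minimizer (`eventually_eq_closedFormEstimator`). Hence any minimizing estimator eventually coincides
with the closed-form one, and has the same limit in distribution.
-/

namespace ScoreMatching

/-! ### The multivariate central limit theorem and stability of limits in distribution -/

section Probability

variable {Ω : Type*} [MeasurableSpace Ω] {P : Measure Ω} {m : ℕ}

lemma variance_inner_eq_covMatrix [IsProbabilityMeasure P] {V : Ω → EuclideanSpace ℝ (Fin m)}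
    (hV : MemLp V 2 P) (t : EuclideanSpace ℝ (Fin m)) :
    Var[fun ω => ⟪V ω, t⟫_ℝ; P] = t ⬝ᵥ covMatrix V P *ᵥ t := by
  have hVi (i : Fin m) : MemLp (fun ω => V ω i) 2 P := hV.eval_piLp i
  have h : (fun ω => ⟪V ω, t⟫_ℝ) = fun ω => ∑ i, t i * V ω i := by
    ext ω; simp [PiLp.inner_apply]
  rw [h, variance_fun_sum' (fun i _ => (hVi i).const_mul _)]
  simp only [dotProduct, Matrix.mulVec, covMatrix, Matrix.of_apply, Finset.mul_sum,
    covariance_const_mul_left, covariance_const_mul_right]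
  refine Finset.sum_congr rfl fun i _ => Finset.sum_congr rfl fun j _ => ?_
  ring

lemma posSemidef_covMatrix [IsProbabilityMeasure P] {V : Ω → EuclideanSpace ℝ (Fin m)}
    (hV : MemLp V 2 P) : (covMatrix V P).PosSemidef := by
  refine Matrix.PosSemidef.of_dotProduct_mulVec_nonneg ?_ fun t => ?_
  · ext i j
    simp [covMatrix, covariance_comm]
  · have := variance_inner_eq_covMatrix hV (WithLp.toLp 2 t)
    simp only [star_trivial] at *
    rw [← this]
    exact variance_nonneg _ _

/-- The **multivariate central limit theorem** for centered vectors. By Lévy's continuity theorem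
only characteristic functions matter, and at `t` the claim is the one-dimensional theorem for the
projections `⟪V k, t⟫`. -/
theorem tendstoInDistribution_inv_sqrt_smul_sum [IsProbabilityMeasure P]
    {V : ℕ → Ω → EuclideanSpace ℝ (Fin m)} (hV : MemLp (V 0) 2 P) (h0 : P[V 0] = 0)
    (hindep : iIndepFun V P) (hident : ∀ k, IdentDistrib (V k) (V 0) P P) :
    TendstoInDistribution (fun (n : ℕ) ω => (√(n : ℝ))⁻¹ • ∑ k ∈ Finset.range n, V k ω)
      atTop id (fun _ => P) (multivariateGaussian 0 (covMatrix (V 0) P)) := by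
  have hmeas (n : ℕ) : AEMeasurable
      (fun ω => (√(n : ℝ))⁻¹ • ∑ k ∈ Finset.range n, V k ω) P := by
    have (k : ℕ) : AEMeasurable (V k) P := (hident k).aemeasurable_fst
    fun_prop
  refine ⟨hmeas, aemeasurable_id, ?_⟩
  refine ProbabilityMeasure.tendsto_iff_tendsto_charFun.2 fun t => ?_
  have hproj (k : ℕ) : IdentDistrib (fun ω => ⟪V k ω, t⟫_ℝ) (fun ω => ⟪V 0 ω, t⟫_ℝ) P P :=
    (hident k).comp (u := fun v => ⟪v, t⟫_ℝ) (by fun_prop)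
  have hmean : ∫ ω, ⟪V 0 ω, t⟫_ℝ ∂P = 0 := by
    simp_rw [real_inner_comm]
    rw [integral_inner (hV.integrable (by simp)), h0, inner_zero_right]
  have hclt := tendstoInDistribution_inv_sqrt_mul_sum_sub
    (Y := id) (P := P) (X := fun k ω => ⟪V k ω, t⟫_ℝ) HasLaw.id
    (hV.inner_const t) (hindep.comp (fun _ v => ⟪v, t⟫_ℝ) (fun _ => by fun_prop)) hproj
  -- The characteristic function of a vector at `t` is that of its projection on `t` at `1`.
  have h1 := ProbabilityMeasure.tendsto_iff_tendsto_charFun.1 hclt.tendsto 1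
  simp only [hmean, mul_zero, sub_zero, ProbabilityMeasure.coe_mk, Measure.map_id,
    charFun_gaussianReal] at h1 ⊢
  rw [charFun_multivariateGaussian (posSemidef_covMatrix hV), ← variance_inner_eq_covMatrix hV]
  convert! h1 using 2 with n
  · rw [charFun_apply, charFun_apply, integral_map (hmeas n) (by fun_prop),
      integral_map _ (by fun_prop)]
    · simp [inner_smul_left, sum_inner]
    · exact (Finset.aemeasurable_fun_sum _ fun k _ =>
        (hproj k).aemeasurable_fst).const_mul _
  · simp [variance_nonneg]

lemma multivariateGaussian_map_mulVec {S : Matrix (Fin m) (Fin m) ℝ} (hS : S.PosSemidef)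
    (A : Matrix (Fin m) (Fin m) ℝ) :
    (multivariateGaussian 0 S).map
        (fun z : EuclideanSpace ℝ (Fin m) => WithLp.toLp 2 (A *ᵥ (z : Fin m → ℝ))) =
      multivariateGaussian 0 (A * S * Aᵀ) := by
  have hA : (A * S * Aᵀ).PosSemidef := by
    simpa using hS.mul_mul_conjTranspose_same A
  have : IsProbabilityMeasure ((multivariateGaussian 0 S).map
      (fun z : EuclideanSpace ℝ (Fin m) => WithLp.toLp 2 (A *ᵥ (z : Fin m → ℝ)))) :=
    Measure.isProbabilityMeasure_map (by fun_prop)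
  refine Measure.ext_of_charFun ?_
  ext t
  have key : charFun ((multivariateGaussian 0 S).map
      (fun z : EuclideanSpace ℝ (Fin m) => WithLp.toLp 2 (A *ᵥ (z : Fin m → ℝ)))) t =
      charFun (multivariateGaussian 0 S) (WithLp.toLp 2 (Aᵀ *ᵥ (t : Fin m → ℝ))) := by
    rw [charFun_apply, charFun_apply, integral_map (by fun_prop) (by fun_prop)]
    congr 1 with z
    congr 3
    simp only [EuclideanSpace.inner_eq_star_dotProduct, star_trivial]
    rw [Matrix.dotProduct_mulVec, Matrix.mulVec_transpose]
  rw [key, charFun_multivariateGaussian hS, charFun_multivariateGaussian hA]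
  congr 1
  simp only [inner_zero_right, Complex.ofReal_zero, zero_mul, zero_sub]
  congr 3
  rw [← Matrix.mulVec_mulVec, ← Matrix.mulVec_mulVec, Matrix.dotProduct_mulVec (t : Fin m → ℝ) A,
    Matrix.mulVec_transpose]

lemma _root_.MeasureTheory.TendstoInDistribution.of_map_eq
    {E Ω' Ω'' : Type*} [TopologicalSpace E] [MeasurableSpace E] [OpensMeasurableSpace E]
    [MeasurableSpace Ω'] [MeasurableSpace Ω''] {μ' : Measure Ω'} {μ'' : Measure Ω''}
    [IsProbabilityMeasure P] [IsProbabilityMeasure μ'] [IsProbabilityMeasure μ'']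
    {X : ℕ → Ω → E} {Z : Ω' → E} {W : Ω'' → E}
    (h : TendstoInDistribution X atTop Z (fun _ => P) μ') (hW : AEMeasurable W μ'')
    (hZW : μ'.map Z = μ''.map W) :
    TendstoInDistribution X atTop W (fun _ => P) μ'' where
  forall_aemeasurable := h.forall_aemeasurable
  aemeasurable_limit := hW
  tendsto := by
    convert! h.tendsto using 3
    congr 1
    exact Subtype.ext hZW.symm

/-- Modifying each variable on finitely many indices, almost surely, does not change the limit in
distribution. -/
lemma _root_.MeasureTheory.TendstoInDistribution.congr_ae_eventually
    {E Ω' : Type*} [NormedAddCommGroup E] [MeasurableSpace E] [BorelSpace E]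
    [SecondCountableTopology E] [MeasurableSpace Ω'] {μ' : Measure Ω'}
    [IsProbabilityMeasure P] [IsProbabilityMeasure μ'] {X Y : ℕ → Ω → E} {Z : Ω' → E}
    (h : TendstoInDistribution X atTop Z (fun _ => P) μ') (hY : ∀ n, AEMeasurable (Y n) P)
    (hXY : ∀ᵐ ω ∂P, ∀ᶠ n in atTop, X n ω = Y n ω) :
    TendstoInDistribution Y atTop Z (fun _ => P) μ' := by
  refine tendstoInDistribution_of_tendstoInMeasure_sub Y Z h ?_ hY
  refine tendstoInMeasure_of_tendsto_ae
    (fun n => ((hY n).sub (h.forall_aemeasurable n)).aestronglyMeasurable) ?_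
  filter_upwards [hXY] with ω hω
  refine tendsto_const_nhds.congr' ?_
  filter_upwards [hω] with n hn
  simp [hn]

end Probability

/-! ### Integrals of divergences -/

section Divergence

variable {d : ℕ}

/-- A smooth cutoff that equals `1` near `0` and is supported in the ball of radius `2`. -/
noncomputable def cutoff (d : ℕ) : ContDiffBump (0 : EuclideanSpace ℝ (Fin d)) where
  rIn := 1
  rOut := 2
  rIn_pos := one_pos
  rIn_lt_rOut := one_lt_two

/-- The cutoff rescaled so that it equals `1` on the ball of radius `n + 1`. -/
noncomputable def scaledCutoff (d n : ℕ) (x : EuclideanSpace ℝ (Fin d)) : ℝ :=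
  cutoff d (((n : ℝ) + 1)⁻¹ • x)

lemma contDiff_scaledCutoff (n : ℕ) : ContDiff ℝ 1 (scaledCutoff d n) :=
  (cutoff d).contDiff.comp (contDiff_const_smul _)

lemma hasCompactSupport_scaledCutoff (n : ℕ) : HasCompactSupport (scaledCutoff d n) :=
  (cutoff d).hasCompactSupport.comp_homeomorph
    (Homeomorph.smulOfNeZero ((n : ℝ) + 1)⁻¹ (by positivity))

lemma norm_scaledCutoff_le_one (n : ℕ) (x : EuclideanSpace ℝ (Fin d)) :
    ‖scaledCutoff d n x‖ ≤ 1 := by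
  rw [scaledCutoff, Real.norm_of_nonneg (cutoff d).nonneg]
  exact (cutoff d).le_one

lemma tendsto_scaledCutoff (x : EuclideanSpace ℝ (Fin d)) :
    Tendsto (fun n => scaledCutoff d n x) atTop (𝓝 1) := by
  have h : Tendsto (fun n : ℕ => ((n : ℝ) + 1)⁻¹ • x) atTop (𝓝 0) := by
    have := (tendsto_one_div_add_atTop_nhds_zero_nat (𝕜 := ℝ)).smul_const x
    simpa using this
  have h1 : cutoff d (0 : EuclideanSpace ℝ (Fin d)) = 1 :=
    (cutoff d).one_of_mem_closedBall (by simp [cutoff])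
  have := ((cutoff d).continuous.tendsto 0).comp h
  rwa [h1] at this

lemma exists_norm_fderiv_scaledCutoff_le (d : ℕ) : ∃ C, ∀ (n : ℕ) (x : EuclideanSpace ℝ (Fin d)),
    ‖fderiv ℝ (scaledCutoff d n) x‖ ≤ ((n : ℝ) + 1)⁻¹ * C := by
  obtain ⟨C, hC⟩ := ((cutoff d).hasCompactSupport.fderiv (𝕜 := ℝ)).exists_bound_of_continuous
    ((cutoff d).contDiff.continuous_fderiv (n := 1) one_ne_zero)
  refine ⟨C, fun n x => ?_⟩
  have : fderiv ℝ (scaledCutoff d n) x =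
      ((n : ℝ) + 1)⁻¹ • fderiv ℝ (cutoff d) (((n : ℝ) + 1)⁻¹ • x) :=
    fderiv_comp_smul (f := cutoff d) _
  rw [this, norm_smul, Real.norm_of_nonneg (by positivity)]
  exact mul_le_mul_of_nonneg_left (hC _) (by positivity)

/-- The divergence of an integrable `C¹` vector field on `ℝᵈ` integrates to zero as soon as it is
integrable: there is no flux through infinity. Only the divergence, and not the individual partial
derivatives, needs to be integrable. -/
theorem integral_divergence_eq_zero {v : Fin d → EuclideanSpace ℝ (Fin d) → ℝ}
    (hv : ∀ j, ContDiff ℝ 1 (v j)) (hint : ∀ j, Integrable (v j))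
    (hdiv : Integrable fun x => ∑ j, fderiv ℝ (v j) x (EuclideanSpace.single j 1)) :
    ∫ x, ∑ j, fderiv ℝ (v j) x (EuclideanSpace.single j 1) = 0 := by
  set D : EuclideanSpace ℝ (Fin d) → ℝ :=
    fun x => ∑ j, fderiv ℝ (v j) x (EuclideanSpace.single j 1) with hD
  have hdc (j : Fin d) : Continuous fun x => fderiv ℝ (v j) x (EuclideanSpace.single j 1) :=
    ((hv j).continuous_fderiv one_ne_zero).clm_apply continuous_const
  have hχc (n : ℕ) : Continuous (scaledCutoff d n) := (contDiff_scaledCutoff n).continuous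
  have hχ'c (n : ℕ) (j : Fin d) :
      Continuous fun x => fderiv ℝ (scaledCutoff d n) x (EuclideanSpace.single j 1) :=
    ((contDiff_scaledCutoff n).continuous_fderiv one_ne_zero).clm_apply continuous_const
  have hχ's (n : ℕ) (j : Fin d) :
      HasCompactSupport fun x => fderiv ℝ (scaledCutoff d n) x (EuclideanSpace.single j 1) :=
    (hasCompactSupport_scaledCutoff n).fderiv_apply (𝕜 := ℝ) _
  have hI1 (n : ℕ) (j : Fin d) : Integrable fun x =>
      scaledCutoff d n x * fderiv ℝ (v j) x (EuclideanSpace.single j 1) :=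
    ((hχc n).mul (hdc j)).integrable_of_hasCompactSupport
      (hasCompactSupport_scaledCutoff n).mul_right
  have hI2 (n : ℕ) (j : Fin d) : Integrable fun x =>
      fderiv ℝ (scaledCutoff d n) x (EuclideanSpace.single j 1) * v j x :=
    ((hχ'c n j).mul (hv j).continuous).integrable_of_hasCompactSupport (hχ's n j).mul_right
  -- Integration by parts against the compactly supported cutoff `χₙ`: `∫ χₙ D = -∫ ⟨∇χₙ, v⟩`.
  have hparts (n : ℕ) : ∫ x, scaledCutoff d n x * D x =
      -∫ x, ∑ j, fderiv ℝ (scaledCutoff d n) x (EuclideanSpace.single j 1) * v j x := by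
    simp only [hD, Finset.mul_sum]
    rw [integral_finsetSum _ fun j _ => hI1 n j, integral_finsetSum _ fun j _ => hI2 n j,
      ← Finset.sum_neg_distrib]
    refine Finset.sum_congr rfl fun j _ => ?_
    exact integral_mul_fderiv_eq_neg_fderiv_mul_of_integrable (hI2 n j) (hI1 n j)
      (((hχc n).mul (hv j).continuous).integrable_of_hasCompactSupport
        (hasCompactSupport_scaledCutoff n).mul_right)
      (fun x _ => (contDiff_scaledCutoff n).differentiable one_ne_zero x)
      (fun x _ => (hv j).differentiable one_ne_zero x)
  have hlim : Tendsto (fun n => ∫ x, scaledCutoff d n x * D x) atTop (𝓝 (∫ x, D x)) := by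
    refine tendsto_integral_of_dominated_convergence (fun x => ‖D x‖)
      (fun n => (hχc n).aestronglyMeasurable.mul hdiv.aestronglyMeasurable) hdiv.norm
      (fun n => ae_of_all _ fun x => ?_) (ae_of_all _ fun x => ?_)
    · rw [norm_mul]
      exact mul_le_of_le_one_left (norm_nonneg _) (norm_scaledCutoff_le_one n x)
    · simpa using (tendsto_scaledCutoff x).mul_const (D x)
  obtain ⟨C, hC⟩ := exists_norm_fderiv_scaledCutoff_le d
  -- On the other hand `|∇χₙ| ≤ C / (n + 1)`, so these integrals tend to `0`.
  have hzero : Tendsto (fun n => ∫ x, scaledCutoff d n x * D x) atTop (𝓝 0) := by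
    have hb : Tendsto (fun n : ℕ => ((n : ℝ) + 1)⁻¹ * (C * ∫ x, ∑ j, ‖v j x‖)) atTop (𝓝 0) := by
      simpa using (tendsto_one_div_add_atTop_nhds_zero_nat (𝕜 := ℝ)).mul_const
        (C * ∫ x, ∑ j, ‖v j x‖)
    refine squeeze_zero_norm (fun n => ?_) hb
    rw [hparts, norm_neg, ← mul_assoc, ← integral_const_mul]
    refine norm_integral_le_of_norm_le
      ((integrable_finsetSum _ fun j _ => (hint j).norm).const_mul _) (ae_of_all _ fun x => ?_)
    rw [Finset.mul_sum]
    refine norm_sum_le_of_le _ fun j _ => ?_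
    rw [norm_mul]
    refine mul_le_mul_of_nonneg_right ?_ (norm_nonneg _)
    refine (ContinuousLinearMap.le_opNorm _ _).trans ?_
    simpa using hC n x
  exact tendsto_nhds_unique hlim hzero

end Divergence

/-! ### Moment identities of the exponential family -/

section Family

variable {d m : ℕ} {F : EuclideanSpace ℝ (Fin d) → EuclideanSpace ℝ (Fin m)}

lemma hasFDerivAt_coord (hF : ContDiff ℝ 2 F) (i : Fin m) (x : EuclideanSpace ℝ (Fin d)) :
    HasFDerivAt (fun y => F y i) ((EuclideanSpace.proj i).comp (fderiv ℝ F x)) x :=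
  ((EuclideanSpace.proj (𝕜 := ℝ) i).hasFDerivAt).comp x
    (hF.differentiable two_ne_zero x).hasFDerivAt

lemma fderiv_coord_single (hF : ContDiff ℝ 2 F) (i : Fin m) (j : Fin d)
    (x : EuclideanSpace ℝ (Fin d)) :
    fderiv ℝ (fun y => F y i) x (EuclideanSpace.single j 1) = jacobian F x i j := by
  rw [(hasFDerivAt_coord hF i x).fderiv]
  rfl

lemma contDiff_coord (hF : ContDiff ℝ 2 F) (i : Fin m) : ContDiff ℝ 2 fun y => F y i :=
  (EuclideanSpace.proj (𝕜 := ℝ) i).contDiff.comp hF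

lemma contDiff_jacobian (hF : ContDiff ℝ 2 F) (i : Fin m) (j : Fin d) :
    ContDiff ℝ 1 fun x => jacobian F x i j := by
  simp_rw [← fderiv_coord_single hF i j]
  exact ((contDiff_coord hF i).fderiv_right (m := 1) (by norm_num)).clm_apply contDiff_const

lemma laplacian_eq_sum_fderiv {f : EuclideanSpace ℝ (Fin d) → ℝ} (hf : ContDiff ℝ 2 f)
    (x : EuclideanSpace ℝ (Fin d)) :
    Laplacian.laplacian f x = ∑ j, fderiv ℝ
      (fun y => fderiv ℝ f y (EuclideanSpace.single j 1)) x (EuclideanSpace.single j 1) := by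
  rw [InnerProductSpace.laplacian_eq_iteratedFDeriv_orthonormalBasis f
    (EuclideanSpace.basisFun (Fin d) ℝ)]
  refine Finset.sum_congr rfl fun j _ => ?_
  have hd : DifferentiableAt ℝ (fderiv ℝ f) x :=
    (hf.fderiv_right (m := 1) (by norm_num)).differentiable one_ne_zero x
  rw [iteratedFDeriv_two_apply, fderiv_clm_apply hd (differentiableAt_const _)]
  simp

lemma lap_apply (hF : ContDiff ℝ 2 F) (x : EuclideanSpace ℝ (Fin d)) (i : Fin m) :
    lap F x i = ∑ j, fderiv ℝ (fun y => jacobian F y i j) x (EuclideanSpace.single j 1) := by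
  simp_rw [← fderiv_coord_single hF i]
  exact laplacian_eq_sum_fderiv (contDiff_coord hF i) x

lemma continuous_gram (hF : ContDiff ℝ 2 F) : Continuous (gram F) := by
  have : Continuous (jacobian F) :=
    continuous_matrix fun i j => (contDiff_jacobian hF i j).continuous
  exact this.matrix_mul this.matrix_transpose

lemma continuous_lap (hF : ContDiff ℝ 2 F) : Continuous (lap F) := by
  refine (PiLp.continuous_toLp 2 _).comp (continuous_pi fun i => ?_)
  change Continuous fun x => lap F x i
  simp_rw [lap_apply hF]
  exact continuous_finsetSum _ fun j _ =>
    ((contDiff_jacobian hF i j).continuous_fderiv one_ne_zero).clm_apply continuous_const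

lemma continuous_scoreVec (hF : ContDiff ℝ 2 F) (θ : EuclideanSpace ℝ (Fin m)) :
    Continuous (scoreVec F θ) :=
  ((PiLp.continuous_toLp 2 _).comp
    ((continuous_gram hF).matrix_mulVec continuous_const)).add (continuous_lap hF)

/-- The directional derivatives of `⟨θ, F⟩` are the entries of `(JF)ᵀ θ`. -/
lemma fderiv_inner_single (hF : ContDiff ℝ 2 F) (θ : EuclideanSpace ℝ (Fin m))
    (x : EuclideanSpace ℝ (Fin d)) (j : Fin d) :
    fderiv ℝ (fun y => ⟪θ, F y⟫_ℝ) x (EuclideanSpace.single j 1) =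
      ((jacobian F x)ᵀ *ᵥ (θ : Fin m → ℝ)) j := by
  have h : (fun y => ⟪θ, F y⟫_ℝ) = fun y => ∑ i, θ i * F y i := by
    ext y; simp [PiLp.inner_apply, mul_comm]
  rw [h, fderiv_fun_sum fun i _ => (hasFDerivAt_coord hF i x).differentiableAt.const_mul _]
  simp only [_root_.sum_apply, Matrix.mulVec, dotProduct, Matrix.transpose_apply]
  refine Finset.sum_congr rfl fun i _ => ?_
  rw [fderiv_const_mul (hasFDerivAt_coord hF i x).differentiableAt]
  simp [fderiv_coord_single hF, mul_comm]

lemma dotProduct_gram_mulVec (x : EuclideanSpace ℝ (Fin d)) (t : Fin m → ℝ) :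
    t ⬝ᵥ gram F x *ᵥ t = ((jacobian F x)ᵀ *ᵥ t) ⬝ᵥ ((jacobian F x)ᵀ *ᵥ t) := by
  rw [gram, ← Matrix.mulVec_mulVec, Matrix.dotProduct_mulVec, ← Matrix.mulVec_transpose]

lemma unnormalizedDensity_pos (θ : EuclideanSpace ℝ (Fin m)) (x : EuclideanSpace ℝ (Fin d)) :
    0 < unnormalizedDensity F θ x := Real.exp_pos _

lemma integral_unnormalizedDensity_pos {θ : EuclideanSpace ℝ (Fin m)}
    (hθ : θ ∈ naturalParameters F) : 0 < ∫ x, unnormalizedDensity F θ x := by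
  rw [integral_pos_iff_support_of_nonneg (fun x => (unnormalizedDensity_pos θ x).le) hθ]
  have : Function.support (unnormalizedDensity F θ) = Set.univ :=
    Set.eq_univ_of_forall fun x => (unnormalizedDensity_pos θ x).ne'
  rw [this]
  exact NeZero.pos _

lemma density_pos {θ : EuclideanSpace ℝ (Fin m)} (hθ : θ ∈ naturalParameters F)
    (x : EuclideanSpace ℝ (Fin d)) : 0 < density F θ x :=
  div_pos (unnormalizedDensity_pos θ x) (integral_unnormalizedDensity_pos hθ)

lemma contDiff_density (hF : ContDiff ℝ 2 F) (θ : EuclideanSpace ℝ (Fin m)) :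
    ContDiff ℝ 2 (density F θ) :=
  (Real.contDiff_exp.comp (contDiff_const.inner ℝ hF)).div_const _

lemma fderiv_density_single (hF : ContDiff ℝ 2 F) (θ : EuclideanSpace ℝ (Fin m))
    (x : EuclideanSpace ℝ (Fin d)) (j : Fin d) :
    fderiv ℝ (density F θ) x (EuclideanSpace.single j 1) =
      density F θ x * ((jacobian F x)ᵀ *ᵥ (θ : Fin m → ℝ)) j := by
  have hd : DifferentiableAt ℝ (fun y => ⟪θ, F y⟫_ℝ) x :=
    (contDiff_const.inner ℝ hF).differentiable two_ne_zero x
  have h : HasFDerivAt (density F θ) ((∫ y, unnormalizedDensity F θ y)⁻¹ •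
      (Real.exp ⟪θ, F x⟫_ℝ • fderiv ℝ (fun y => ⟪θ, F y⟫_ℝ) x)) x := by
    have := hd.hasFDerivAt.exp.const_mul (∫ y, unnormalizedDensity F θ y)⁻¹
    refine this.congr_of_eventuallyEq (Eventually.of_forall fun y => ?_)
    simp [density, unnormalizedDensity, div_eq_inv_mul]
  rw [h.fderiv]
  simp only [_root_.smul_apply, fderiv_inner_single hF, smul_eq_mul, density,
    unnormalizedDensity, div_eq_inv_mul]
  ring

lemma isProbabilityMeasure_dist {θ : EuclideanSpace ℝ (Fin m)} (hθ : θ ∈ naturalParameters F) :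
    IsProbabilityMeasure (dist F θ) := by
  refine ⟨?_⟩
  rw [dist, withDensity_apply _ MeasurableSet.univ, Measure.restrict_univ,
    ← ofReal_integral_eq_lintegral_ofReal (f := density F θ) (Integrable.div_const hθ _)
      (ae_of_all _ fun x => (density_pos hθ x).le)]
  simp only [density]
  rw [integral_div, div_self (integral_unnormalizedDensity_pos hθ).ne', ENNReal.ofReal_one]

lemma integral_dist (hF : ContDiff ℝ 2 F) {θ : EuclideanSpace ℝ (Fin m)}
    (hθ : θ ∈ naturalParameters F) (f : EuclideanSpace ℝ (Fin d) → ℝ) :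
    ∫ x, f x ∂(dist F θ) = ∫ x, density F θ x * f x := by
  rw [dist, integral_withDensity_eq_integral_toReal_smul
    (contDiff_density hF θ).continuous.measurable.ennreal_ofReal (by simp)]
  simp [ENNReal.toReal_ofReal (density_pos hθ _).le]

lemma integrable_dist_iff (hF : ContDiff ℝ 2 F) {θ : EuclideanSpace ℝ (Fin m)}
    (hθ : θ ∈ naturalParameters F) {f : EuclideanSpace ℝ (Fin d) → ℝ} :
    Integrable f (dist F θ) ↔ Integrable fun x => density F θ x * f x := by
  rw [dist, integrable_withDensity_iff_integrable_smul'
    (contDiff_density hF θ).continuous.measurable.ennreal_ofReal (by simp)]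
  simp [ENNReal.toReal_ofReal (density_pos hθ _).le]

lemma volume_absolutelyContinuous_dist (hF : ContDiff ℝ 2 F) {θ : EuclideanSpace ℝ (Fin m)}
    (hθ : θ ∈ naturalParameters F) :
    (volume : Measure (EuclideanSpace ℝ (Fin d))) ≪ dist F θ := by
  refine withDensity_absolutelyContinuous'
    (contDiff_density hF θ).continuous.measurable.ennreal_ofReal.aemeasurable
    (ae_of_all _ fun x => ?_)
  simpa using density_pos hθ x

/-- The divergence of `p_θ ∇F_i` is `p_θ` times the `i`-th coordinate of `JF JFᵀ θ + ΔF`. -/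
lemma divergence_density_mul_jacobian (hF : ContDiff ℝ 2 F) (θ : EuclideanSpace ℝ (Fin m))
    (i : Fin m) (x : EuclideanSpace ℝ (Fin d)) :
    ∑ j, fderiv ℝ (fun y => density F θ y * jacobian F y i j) x (EuclideanSpace.single j 1) =
      density F θ x * scoreVec F θ x i := by
  have h (j : Fin d) :
      fderiv ℝ (fun y => density F θ y * jacobian F y i j) x (EuclideanSpace.single j 1) =
      density F θ x * (jacobian F x i j * ((jacobian F x)ᵀ *ᵥ (θ : Fin m → ℝ)) j) +
      density F θ x * fderiv ℝ (fun y => jacobian F y i j) x (EuclideanSpace.single j 1) := by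
    rw [fderiv_fun_mul ((contDiff_density hF θ).differentiable two_ne_zero x)
      ((contDiff_jacobian hF i j).differentiable one_ne_zero x)]
    simp only [_root_.add_apply, _root_.smul_apply, smul_eq_mul,
      fderiv_density_single hF]
    ring
  simp only [h, Finset.sum_add_distrib, ← Finset.mul_sum, ← lap_apply hF]
  rw [← mul_add]
  congr 1
  simp only [scoreVec, gram, PiLp.add_apply, ← Matrix.mulVec_mulVec]
  rfl

/-- **Unbiasedness of the score matching equations**: `E[JF JFᵀ θ + ΔF] = 0` under `p_θ`. -/
theorem integral_scoreVec_eq_zero (hF : ContDiff ℝ 2 F) {θ : EuclideanSpace ℝ (Fin m)}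
    (hθ : θ ∈ naturalParameters F)
    (hJ : ∀ i j, Integrable (fun x => jacobian F x i j) (dist F θ))
    (hS : Integrable (scoreVec F θ) (dist F θ)) :
    ∫ x, scoreVec F θ x ∂(dist F θ) = 0 := by
  ext i
  have hSi : Integrable (fun x => scoreVec F θ x i) (dist F θ) := hS.eval_piLp i
  have hcoord : (∫ x, scoreVec F θ x ∂(dist F θ)) i = ∫ x, scoreVec F θ x i ∂(dist F θ) :=
    ((EuclideanSpace.proj (𝕜 := ℝ) i).integral_comp_comm hS).symm
  rw [hcoord, integral_dist hF hθ]
  simp_rw [← divergence_density_mul_jacobian hF]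
  refine integral_divergence_eq_zero
    (fun j => ((contDiff_density hF θ).of_le (by norm_num)).mul (contDiff_jacobian hF i j))
    (fun j => (integrable_dist_iff hF hθ).1 (hJ i j)) ?_
  simp_rw [divergence_density_mul_jacobian hF]
  exact (integrable_dist_iff hF hθ).1 hSi

lemma integrable_gram {P : Measure (EuclideanSpace ℝ (Fin d))}
    (hJ : ∀ i j, MemLp (fun x => jacobian F x i j) 2 P) (i k : Fin m) :
    Integrable (fun x => gram F x i k) P := by
  simp only [gram, Matrix.mul_apply, Matrix.transpose_apply]
  exact integrable_finsetSum _ fun j _ => (hJ i j).integrable_mul (hJ k j)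

/-- A direction `t` with `(JF)ᵀ t = 0` everywhere leaves `⟨t, F⟩` constant, so that translating the
parameter by `t` does not change the density. -/
lemma density_add_eq_of_jacobian_transpose_mulVec_eq_zero (hF : ContDiff ℝ 2 F)
    {θ t : EuclideanSpace ℝ (Fin m)} (hθ : θ ∈ naturalParameters F)
    (h : ∀ x, (jacobian F x)ᵀ *ᵥ (t : Fin m → ℝ) = 0) :
    θ + t ∈ naturalParameters F ∧ density F (θ + t) = density F θ := by
  have hfd : ∀ x, fderiv ℝ (fun y => ⟪t, F y⟫_ℝ) x = 0 := fun x => by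
    refine ContinuousLinearMap.coe_injective
      ((EuclideanSpace.basisFun (Fin d) ℝ).toBasis.ext fun j => ?_)
    simp [fderiv_inner_single hF, h x]
  have hconst (x : EuclideanSpace ℝ (Fin d)) : ⟪t, F x⟫_ℝ = ⟪t, F 0⟫_ℝ :=
    is_const_of_fderiv_eq_zero
      ((contDiff_const.inner ℝ hF).differentiable two_ne_zero) hfd x 0
  have hu : unnormalizedDensity F (θ + t) =
      fun x => Real.exp ⟪t, F 0⟫_ℝ * unnormalizedDensity F θ x := by
    ext x
    simp only [unnormalizedDensity, inner_add_left, hconst x, Real.exp_add]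
    ring
  refine ⟨?_, ?_⟩
  · change Integrable _ _
    rw [hu]
    exact Integrable.const_mul hθ _
  · ext x
    simp only [density, hu]
    rw [integral_const_mul, mul_div_mul_left _ _ (Real.exp_pos _).ne']

lemma dotProduct_expMatrix_gram_mulVec {P : Measure (EuclideanSpace ℝ (Fin d))}
    (hJ : ∀ i j, MemLp (fun x => jacobian F x i j) 2 P) (t : Fin m → ℝ) :
    t ⬝ᵥ expMatrix (gram F) P *ᵥ t =
      ∫ x, ((jacobian F x)ᵀ *ᵥ t) ⬝ᵥ ((jacobian F x)ᵀ *ᵥ t) ∂P := by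
  simp_rw [← dotProduct_gram_mulVec]
  simp only [dotProduct, Matrix.mulVec, expMatrix, Matrix.of_apply]
  have hi (i k : Fin m) := integrable_gram hJ i k
  rw [integral_finsetSum _ fun i _ =>
    (integrable_finsetSum _ fun k _ => (hi i k).mul_const _).const_mul _]
  refine Finset.sum_congr rfl fun i _ => ?_
  rw [integral_const_mul, integral_finsetSum _ fun k _ => (hi i k).mul_const _]
  simp_rw [integral_mul_const]

lemma isSymm_gram (x : EuclideanSpace ℝ (Fin d)) : (gram F x).IsSymm := by
  simp [gram, Matrix.IsSymm, Matrix.transpose_mul]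

lemma isSymm_expMatrix_gram (P : Measure (EuclideanSpace ℝ (Fin d))) :
    (expMatrix (gram F) P).IsSymm := by
  ext i k
  simp only [Matrix.transpose_apply, expMatrix, Matrix.of_apply]
  congr 1 with x
  exact (isSymm_gram x).apply i k

/-- Identifiability makes `E[JF JFᵀ]` positive definite: a null vector `t` has `(JF)ᵀ t = 0`
almost everywhere, hence everywhere by continuity, so `θ + t` parametrizes the same density. -/
theorem posDef_expMatrix_gram (hF : ContDiff ℝ 2 F) {θ : EuclideanSpace ℝ (Fin m)}
    (hθ : θ ∈ naturalParameters F)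
    (hid : ∀ θ' ∈ naturalParameters F, density F θ' = density F θ → θ' = θ)
    (hJ : ∀ i j, MemLp (fun x => jacobian F x i j) 2 (dist F θ)) :
    (expMatrix (gram F) (dist F θ)).PosDef := by
  have hnonneg (t : Fin m → ℝ) (x : EuclideanSpace ℝ (Fin d)) :
      0 ≤ ((jacobian F x)ᵀ *ᵥ t) ⬝ᵥ ((jacobian F x)ᵀ *ᵥ t) :=
    by simpa using dotProduct_star_self_nonneg ((jacobian F x)ᵀ *ᵥ t)
  refine Matrix.PosDef.of_dotProduct_mulVec_pos ?_ fun t ht => ?_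
  · simpa [Matrix.IsHermitian, Matrix.IsSymm] using isSymm_expMatrix_gram (F := F) (dist F θ)
  rw [star_trivial, dotProduct_expMatrix_gram_mulVec hJ]
  refine (integral_nonneg (hnonneg t)).lt_of_ne' fun h0 => ht ?_
  have hint : Integrable
      (fun x => ((jacobian F x)ᵀ *ᵥ t) ⬝ᵥ ((jacobian F x)ᵀ *ᵥ t)) (dist F θ) := by
    simp_rw [← dotProduct_gram_mulVec, dotProduct, Matrix.mulVec, dotProduct]
    exact integrable_finsetSum _ fun i _ => (integrable_finsetSum _ fun k _ =>
      (integrable_gram hJ i k).mul_const _).const_mul _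
  have hae : _ =ᵐ[volume] _ := (volume_absolutelyContinuous_dist hF hθ).ae_le
    ((integral_eq_zero_iff_of_nonneg (hnonneg t) hint).1 h0)
  have hcont : Continuous
      fun x => ((jacobian F x)ᵀ *ᵥ t) ⬝ᵥ ((jacobian F x)ᵀ *ᵥ t) := by
    simp_rw [← dotProduct_gram_mulVec]
    exact continuous_const.dotProduct ((continuous_gram hF).matrix_mulVec continuous_const)
  have hall := (hcont.ae_eq_iff_eq volume continuous_zero).1 hae
  have hzero (x : EuclideanSpace ℝ (Fin d)) : (jacobian F x)ᵀ *ᵥ t = 0 :=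
    dotProduct_self_eq_zero.1 (congrFun hall x)
  obtain ⟨h1, h2⟩ := density_add_eq_of_jacobian_transpose_mulVec_eq_zero hF
    (t := WithLp.toLp 2 t) hθ hzero
  have := hid _ h1 h2
  simpa using this

end Family

/-! ### The empirical loss and its minimizer -/

section Estimator

variable {d m : ℕ} {F : EuclideanSpace ℝ (Fin d) → EuclideanSpace ℝ (Fin m)}

/-- The sample average of `f` over `x 0, …, x (n - 1)`; it is `0` for `n = 0`. -/
noncomputable def sampleMean {α E : Type*} [AddCommGroup E] [Module ℝ E] (f : α → E) (n : ℕ)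
    (x : ℕ → α) : E :=
  (n : ℝ)⁻¹ • ∑ k ∈ Finset.range n, f (x k)

lemma closedFormEstimator_eq (n : ℕ) (x : ℕ → EuclideanSpace ℝ (Fin d)) :
    closedFormEstimator F n x =
      WithLp.toLp 2 (-((sampleMean (gram F) n x)⁻¹ *ᵥ (sampleMean (lap F) n x).ofLp)) :=
  rfl

lemma sampleMean_scoreVec (θ : EuclideanSpace ℝ (Fin m)) (n : ℕ)
    (x : ℕ → EuclideanSpace ℝ (Fin d)) :
    (sampleMean (scoreVec F θ) n x).ofLp =
      sampleMean (gram F) n x *ᵥ (θ : Fin m → ℝ) + (sampleMean (lap F) n x).ofLp := by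
  simp only [sampleMean, scoreVec, Finset.sum_add_distrib, smul_add, WithLp.ofLp_add,
    WithLp.ofLp_smul, Matrix.smul_mulVec, Matrix.sum_mulVec, WithLp.ofLp_sum]

/-- The estimation error is the empirical score matching equation at `θ`, transformed by the
inverse empirical matrix. -/
lemma closedFormEstimator_sub {n : ℕ} {x : ℕ → EuclideanSpace ℝ (Fin d)}
    (h : IsUnit (sampleMean (gram F) n x).det) (θ : EuclideanSpace ℝ (Fin m)) :
    closedFormEstimator F n x - θ = WithLp.toLp 2
      (-((sampleMean (gram F) n x)⁻¹ *ᵥ (sampleMean (scoreVec F θ) n x).ofLp)) := by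
  rw [sampleMean_scoreVec, Matrix.mulVec_add, Matrix.mulVec_mulVec, Matrix.nonsing_inv_mul _ h,
    Matrix.one_mulVec, closedFormEstimator_eq]
  ext i
  simp
  ring

lemma posSemidef_gram (x : EuclideanSpace ℝ (Fin d)) : (gram F x).PosSemidef := by
  simpa [gram] using Matrix.posSemidef_self_mul_conjTranspose (jacobian F x)

lemma posSemidef_sampleMean_gram (n : ℕ) (x : ℕ → EuclideanSpace ℝ (Fin d)) :
    (sampleMean (gram F) n x).PosSemidef :=
  (Matrix.posSemidef_sum _ fun _ _ => posSemidef_gram _).smul (by positivity)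

lemma log_density {s : EuclideanSpace ℝ (Fin m)} (hs : s ∈ naturalParameters F)
    (x : EuclideanSpace ℝ (Fin d)) :
    Real.log (density F s x) = ⟪s, F x⟫_ℝ - Real.log (∫ y, unnormalizedDensity F s y) := by
  rw [density, Real.log_div (unnormalizedDensity_pos s x).ne'
    (integral_unnormalizedDensity_pos hs).ne', unnormalizedDensity, Real.log_exp]

lemma contDiff_log_density (hF : ContDiff ℝ 2 F) {s : EuclideanSpace ℝ (Fin m)}
    (hs : s ∈ naturalParameters F) : ContDiff ℝ 2 fun x => Real.log (density F s x) := by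
  simp_rw [log_density hs]
  exact (contDiff_const.inner ℝ hF).sub contDiff_const

lemma fderiv_log_density_single (hF : ContDiff ℝ 2 F) {s : EuclideanSpace ℝ (Fin m)}
    (hs : s ∈ naturalParameters F) (x : EuclideanSpace ℝ (Fin d)) (j : Fin d) :
    fderiv ℝ (fun y => Real.log (density F s y)) x (EuclideanSpace.single j 1) =
      ((jacobian F x)ᵀ *ᵥ (s : Fin m → ℝ)) j := by
  simp_rw [log_density hs]
  rw [fderiv_sub_const, fderiv_inner_single hF]

lemma laplacian_log_density (hF : ContDiff ℝ 2 F) {s : EuclideanSpace ℝ (Fin m)}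
    (hs : s ∈ naturalParameters F) (x : EuclideanSpace ℝ (Fin d)) :
    Laplacian.laplacian (fun y => Real.log (density F s y)) x =
      (s : Fin m → ℝ) ⬝ᵥ (lap F x : Fin m → ℝ) := by
  rw [laplacian_eq_sum_fderiv (contDiff_log_density hF hs)]
  simp_rw [fderiv_log_density_single hF hs, dotProduct, lap_apply hF, Finset.mul_sum]
  rw [Finset.sum_comm]
  refine Finset.sum_congr rfl fun j _ => ?_
  have hd (i : Fin m) : DifferentiableAt ℝ (fun y => jacobian F y i j) x :=
    (contDiff_jacobian hF i j).differentiable one_ne_zero x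
  simp only [Matrix.mulVec, dotProduct, Matrix.transpose_apply]
  rw [fderiv_fun_sum fun i _ => (hd i).mul_const _, _root_.sum_apply]
  refine Finset.sum_congr rfl fun i _ => ?_
  rw [fderiv_mul_const (hd i)]
  simp

lemma norm_sq_gradient_log_density (hF : ContDiff ℝ 2 F) {s : EuclideanSpace ℝ (Fin m)}
    (hs : s ∈ naturalParameters F) (x : EuclideanSpace ℝ (Fin d)) :
    ‖gradient (fun y => Real.log (density F s y)) x‖ ^ 2 =
      (s : Fin m → ℝ) ⬝ᵥ gram F x *ᵥ (s : Fin m → ℝ) := by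
  have h (j : Fin d) : gradient (fun y => Real.log (density F s y)) x j =
      ((jacobian F x)ᵀ *ᵥ (s : Fin m → ℝ)) j := by
    rw [← fderiv_log_density_single hF hs, gradient, ← InnerProductSpace.toDual_symm_apply,
      EuclideanSpace.inner_single_right]
    simp
  rw [EuclideanSpace.real_norm_sq_eq, dotProduct_gram_mulVec]
  simp [h, dotProduct, sq]

/-- The empirical score matching loss of an exponential family is quadratic in the parameter. -/
lemma empiricalLoss_density (hF : ContDiff ℝ 2 F) {s : EuclideanSpace ℝ (Fin m)}
    (hs : s ∈ naturalParameters F) (n : ℕ) (x : ℕ → EuclideanSpace ℝ (Fin d)) :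
    empiricalLoss n x (density F s) =
      (s : Fin m → ℝ) ⬝ᵥ (sampleMean (lap F) n x).ofLp +
        (s : Fin m → ℝ) ⬝ᵥ sampleMean (gram F) n x *ᵥ (s : Fin m → ℝ) / 2 := by
  simp only [empiricalLoss, laplacian_log_density hF hs, norm_sq_gradient_log_density hF hs,
    sampleMean, WithLp.ofLp_smul, WithLp.ofLp_sum, dotProduct_smul, dotProduct_sum,
    Matrix.smul_mulVec, Matrix.sum_mulVec, Finset.sum_add_distrib, Finset.sum_div, smul_eq_mul,
    mul_add, mul_div_assoc]

lemma empiricalLoss_sub_closedFormEstimator (hF : ContDiff ℝ 2 F) {n : ℕ}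
    {x : ℕ → EuclideanSpace ℝ (Fin d)} (h : IsUnit (sampleMean (gram F) n x).det)
    (ht : closedFormEstimator F n x ∈ naturalParameters F)
    {s : EuclideanSpace ℝ (Fin m)} (hs : s ∈ naturalParameters F) :
    empiricalLoss n x (density F s) - empiricalLoss n x (density F (closedFormEstimator F n x)) =
      ((s - closedFormEstimator F n x : EuclideanSpace ℝ (Fin m)) : Fin m → ℝ) ⬝ᵥ
        sampleMean (gram F) n x *ᵥ
          ((s - closedFormEstimator F n x : EuclideanSpace ℝ (Fin m)) : Fin m → ℝ) / 2 := by
  rw [empiricalLoss_density hF hs, empiricalLoss_density hF ht]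
  set A := sampleMean (gram F) n x with hA
  set t := closedFormEstimator F n x with ht'
  have hb : (sampleMean (lap F) n x).ofLp = -(A *ᵥ (t : Fin m → ℝ)) := by
    rw [ht', closedFormEstimator_eq, Matrix.mulVec_neg, Matrix.mulVec_mulVec, ← hA,
      Matrix.mul_nonsing_inv _ h, Matrix.one_mulVec, neg_neg]
  have hsymm : (t : Fin m → ℝ) ⬝ᵥ A *ᵥ (s : Fin m → ℝ) =
      (s : Fin m → ℝ) ⬝ᵥ A *ᵥ (t : Fin m → ℝ) := by
    have hAT : Aᵀ = A := by
      simpa [Matrix.IsHermitian] using (posSemidef_sampleMean_gram (F := F) n x).isHermitian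
    rw [Matrix.dotProduct_mulVec, ← Matrix.mulVec_transpose, hAT, dotProduct_comm]
  rw [hb]
  simp only [WithLp.ofLp_sub, Matrix.mulVec_sub, sub_dotProduct, dotProduct_sub, dotProduct_neg,
    hsymm]
  ring

/-- When the empirical matrix is invertible the loss is strictly convex with critical point
`closedFormEstimator`; if that point is a parameter, it is the only minimizer. -/
theorem isLossMinimizer_closedFormEstimator (hF : ContDiff ℝ 2 F)
    {Θ : Set (EuclideanSpace ℝ (Fin m))} (hΘ : Θ ⊆ naturalParameters F) {n : ℕ}
    {x : ℕ → EuclideanSpace ℝ (Fin d)} (h : IsUnit (sampleMean (gram F) n x).det)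
    (ht : closedFormEstimator F n x ∈ Θ) :
    IsLossMinimizer F Θ n x (closedFormEstimator F n x) ∧
      ∀ s, IsLossMinimizer F Θ n x s → s = closedFormEstimator F n x := by
  have hpos : (sampleMean (gram F) n x).PosDef :=
    (posSemidef_sampleMean_gram n x).posDef_iff_isUnit.2 ((Matrix.isUnit_iff_isUnit_det _).2 h)
  refine ⟨⟨ht, fun s hs => ?_⟩, fun s hs => ?_⟩
  · have h1 := empiricalLoss_sub_closedFormEstimator hF h (hΘ ht) (hΘ hs)
    have h2 := hpos.posSemidef.dotProduct_mulVec_nonneg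
      ((s - closedFormEstimator F n x : EuclideanSpace ℝ (Fin m)) : Fin m → ℝ)
    rw [star_trivial] at h2
    linarith
  · by_contra hne
    have h1 := empiricalLoss_sub_closedFormEstimator hF h (hΘ ht) (hΘ hs.1)
    have h2 := hpos.dotProduct_mulVec_pos
      (x := ((s - closedFormEstimator F n x : EuclideanSpace ℝ (Fin m)) : Fin m → ℝ))
      (by rwa [Ne, WithLp.ofLp_eq_zero, sub_eq_zero])
    have h3 := hs.2 _ ht
    rw [star_trivial] at h2
    linarith

lemma continuous_sampleMean {E : Type*} [AddCommGroup E] [Module ℝ E]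
    [TopologicalSpace E] [ContinuousAdd E] [ContinuousConstSMul ℝ E]
    {f : EuclideanSpace ℝ (Fin d) → E} (hf : Continuous f) (n : ℕ) :
    Continuous (sampleMean f n) :=
  (continuous_finsetSum _ fun k _ => hf.comp (continuous_apply k)).const_smul _

lemma measurable_inv_sampleMean_gram (hF : ContDiff ℝ 2 F) (n : ℕ) (i j : Fin m) :
    Measurable fun x => (sampleMean (gram F) n x)⁻¹ i j := by
  have hc := continuous_sampleMean (continuous_gram hF) n
  simp only [Matrix.inv_def, Matrix.smul_apply, Ring.inverse_eq_inv', smul_eq_mul]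
  exact hc.matrix_det.measurable.inv.mul (hc.matrix_adjugate.matrix_elem i j).measurable

lemma measurable_closedFormEstimator (hF : ContDiff ℝ 2 F) (n : ℕ) :
    Measurable (closedFormEstimator F n) := by
  refine (WithLp.measurable_toLp 2 _).comp (measurable_pi_lambda _ fun i => ?_)
  change Measurable fun x =>
    -∑ j, (sampleMean (gram F) n x)⁻¹ i j * (sampleMean (lap F) n x).ofLp j
  refine Measurable.neg (Finset.measurable_sum _ fun j _ => ?_)
  refine (measurable_inv_sampleMean_gram hF n i j).mul ?_
  exact ((EuclideanSpace.proj (𝕜 := ℝ) j).continuous.comp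
    (continuous_sampleMean (continuous_lap hF) n)).measurable

lemma tendsto_inv_of_tendsto {A : ℕ → Matrix (Fin m) (Fin m) ℝ} {G : Matrix (Fin m) (Fin m) ℝ}
    (hA : Tendsto A atTop (𝓝 G)) (hG : IsUnit G.det) :
    Tendsto (fun n => (A n)⁻¹) atTop (𝓝 G⁻¹) := by
  have hdet := ((continuous_id.matrix_det).tendsto G).comp hA
  have hadj := ((continuous_id.matrix_adjugate).tendsto G).comp hA
  simp only [Matrix.inv_def, Ring.inverse_eq_inv']
  exact (hdet.inv₀ hG.ne_zero).smul hadj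

end Estimator

/-! ### Asymptotic normality -/

section Asymptotics

variable {d m : ℕ} {F : EuclideanSpace ℝ (Fin d) → EuclideanSpace ℝ (Fin m)}
  {θ : EuclideanSpace ℝ (Fin m)} {Ω : Type*} [MeasurableSpace Ω] {μ : Measure Ω}
  {X : ℕ → Ω → EuclideanSpace ℝ (Fin d)}
  {P : Measure (EuclideanSpace ℝ (Fin d))}

/-- The strong law of large numbers for a function of an i.i.d. sample. -/
lemma tendsto_sampleMean_ae {E : Type*} [NormedAddCommGroup E] [NormedSpace ℝ E]
    [CompleteSpace E] [MeasurableSpace E] [BorelSpace E] [SecondCountableTopology E]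
    (hlaw : ∀ k, HasLaw (X k) P μ) (hindep : iIndepFun X μ)
    {f : EuclideanSpace ℝ (Fin d) → E} (hf : Measurable f) (hint : Integrable f P) :
    ∀ᵐ ω ∂μ, Tendsto (fun n => sampleMean f n fun k => X k ω) atTop (𝓝 (∫ x, f x ∂P)) := by
  have hid (k : ℕ) : IdentDistrib (X k) (X 0) μ μ :=
    ⟨(hlaw k).aemeasurable, (hlaw 0).aemeasurable, by rw [(hlaw k).map_eq, (hlaw 0).map_eq]⟩
  have hint0 : Integrable (fun ω => f (X 0 ω)) μ := by
    rw [← (hlaw 0).map_eq] at hint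
    exact hint.comp_aemeasurable (hlaw 0).aemeasurable
  have hmean : ∫ ω, f (X 0 ω) ∂μ = ∫ x, f x ∂P :=
    (hlaw 0).integral_comp hf.aestronglyMeasurable
  have := strong_law_ae (fun k ω => f (X k ω)) hint0
    (fun i j hij => (hindep.indepFun hij).comp hf hf) (fun k => (hid k).comp hf)
  rw [hmean] at this
  exact this

lemma tendsto_sampleMean_gram_ae (hF : ContDiff ℝ 2 F)
    (hJ : ∀ i j, MemLp (fun x => jacobian F x i j) 2 P)
    (hlaw : ∀ k, HasLaw (X k) P μ) (hindep : iIndepFun X μ) :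
    ∀ᵐ ω ∂μ, Tendsto (fun n => sampleMean (gram F) n fun k => X k ω) atTop
      (𝓝 (expMatrix (gram F) P)) := by
  have h (i j : Fin m) := tendsto_sampleMean_ae hlaw hindep
    (f := fun x => gram F x i j) ((continuous_gram hF).matrix_elem i j).measurable
    (integrable_gram hJ i j)
  filter_upwards [ae_all_iff.2 fun i => ae_all_iff.2 (h i)] with ω hω
  refine tendsto_pi_nhds.2 fun i => tendsto_pi_nhds.2 fun j => ?_
  refine (hω i j).congr fun n => ?_
  simp [sampleMean, Matrix.sum_apply]

lemma covMatrix_comp {Y : Ω → EuclideanSpace ℝ (Fin d)} (hY : HasLaw Y P μ)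
    {V : EuclideanSpace ℝ (Fin d) → EuclideanSpace ℝ (Fin m)} (hV : Measurable V) :
    covMatrix (fun ω => V (Y ω)) μ = covMatrix V P := by
  have hVi (i : Fin m) : Measurable fun x => V x i := by fun_prop
  ext i j
  exact hY.covariance_fun_comp (hVi i).aemeasurable (hVi j).aemeasurable

lemma posSemidef_asympCov [IsProbabilityMeasure (dist F θ)]
    (hS : MemLp (scoreVec F θ) 2 (dist F θ)) : (asympCov F θ).PosSemidef := by
  have hT : ((expMatrix (gram F) (dist F θ))⁻¹)ᴴ = (expMatrix (gram F) (dist F θ))⁻¹ := by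
    rw [Matrix.conjTranspose_eq_transpose_of_trivial, Matrix.transpose_nonsing_inv,
      (isSymm_expMatrix_gram _).eq]
  have := (posSemidef_covMatrix hS).mul_mul_conjTranspose_same
    (expMatrix (gram F) (dist F θ))⁻¹
  rwa [hT] at this

/-- Asymptotic normality of the closed-form estimator: by the central limit theorem
`√n Ê[JF JFᵀ θ + ΔF] → N(0, Σ)`, and by Slutsky's theorem multiplication by
`-Ê[JF JFᵀ]⁻¹ → -E[JF JFᵀ]⁻¹` turns this limit into `N(0, Γ)`. -/
theorem tendstoInDistribution_closedFormEstimator (hF : ContDiff ℝ 2 F)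
    [IsProbabilityMeasure μ] [IsProbabilityMeasure (dist F θ)]
    (hdet : IsUnit (expMatrix (gram F) (dist F θ)).det)
    (hmean : ∫ x, scoreVec F θ x ∂(dist F θ) = 0)
    (hJ : ∀ i j, MemLp (fun x => jacobian F x i j) 2 (dist F θ))
    (hS : MemLp (scoreVec F θ) 2 (dist F θ))
    (hlaw : ∀ k, HasLaw (X k) (dist F θ) μ) (hindep : iIndepFun X μ) :
    TendstoInDistribution
      (fun (n : ℕ) ω => √(n : ℝ) • (closedFormEstimator F n (fun k => X k ω) - θ))
      atTop id (fun _ => μ) (multivariateGaussian 0 (asympCov F θ)) := by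
  have hSm : Measurable (scoreVec F θ) := (continuous_scoreVec hF θ).measurable
  have hXm : AEMeasurable (fun ω k => X k ω) μ :=
    aemeasurable_pi_lambda _ fun k => (hlaw k).aemeasurable
  have hclt := tendstoInDistribution_inv_sqrt_smul_sum (P := μ)
    (V := fun k ω => scoreVec F θ (X k ω))
    (by
      rw [← (hlaw 0).map_eq] at hS
      exact hS.comp_of_map (hlaw 0).aemeasurable)
    (by rw [← hmean]; exact (hlaw 0).integral_comp hSm.aestronglyMeasurable)
    (hindep.comp (fun _ => scoreVec F θ) fun _ => hSm)
    (fun k => IdentDistrib.comp (f := X k) (g := X 0) ⟨(hlaw k).aemeasurable, (hlaw 0).aemeasurable,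
      by rw [(hlaw k).map_eq, (hlaw 0).map_eq]⟩ hSm)
  rw [covMatrix_comp (hlaw 0) hSm] at hclt
  have hgram := tendsto_sampleMean_gram_ae hF hJ hlaw hindep
  -- Slutsky's theorem needs a norm, which functions `Fin m → Fin m → ℝ` carry and matrices do not.
  let B : ℕ → Ω → Fin m → Fin m → ℝ := fun n ω i j =>
    (sampleMean (gram F) n fun k => X k ω)⁻¹ i j
  have hBm (n : ℕ) : AEMeasurable (B n) μ :=
    aemeasurable_pi_lambda _ fun i => aemeasurable_pi_lambda _ fun j =>
      (measurable_inv_sampleMean_gram hF n i j).comp_aemeasurable hXm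
  have hB : TendstoInMeasure μ B atTop fun _ i j => (expMatrix (gram F) (dist F θ))⁻¹ i j := by
    refine tendstoInMeasure_of_tendsto_ae (fun n => (hBm n).aestronglyMeasurable) ?_
    filter_upwards [hgram] with ω hω
    exact tendsto_pi_nhds.2 fun i => tendsto_pi_nhds.2 fun j =>
      ((continuous_id.matrix_elem i j).tendsto _).comp (tendsto_inv_of_tendsto hω hdet)
  have hg : Continuous fun p : EuclideanSpace ℝ (Fin m) × (Fin m → Fin m → ℝ) =>
      (WithLp.toLp 2 (-(Matrix.of p.2 *ᵥ (p.1 : Fin m → ℝ))) : EuclideanSpace ℝ (Fin m)) := by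
    refine (PiLp.continuous_toLp 2 _).comp (Continuous.neg ?_)
    exact Continuous.matrix_mulVec (A := fun p : EuclideanSpace ℝ (Fin m) × _ => Matrix.of p.2)
      continuous_snd ((PiLp.continuous_ofLp 2 _).comp continuous_fst)
  have hslutsky := hclt.continuous_comp_prodMk_of_tendstoInMeasure_const hg hB hBm
  have hmap : (multivariateGaussian 0 (covMatrix (scoreVec F θ) (dist F θ))).map
      (fun z : EuclideanSpace ℝ (Fin m) => (WithLp.toLp 2
        (-((expMatrix (gram F) (dist F θ))⁻¹ *ᵥ (z : Fin m → ℝ))) : EuclideanSpace ℝ (Fin m))) =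
      (multivariateGaussian 0 (asympCov F θ)).map id := by
    simp_rw [← Matrix.neg_mulVec]
    rw [multivariateGaussian_map_mulVec (posSemidef_covMatrix hS), Measure.map_id,
      Matrix.transpose_neg, Matrix.transpose_nonsing_inv, (isSymm_expMatrix_gram _).eq,
      Matrix.neg_mul, Matrix.neg_mul, Matrix.mul_neg, neg_neg]
    rfl
  refine (hslutsky.of_map_eq aemeasurable_id hmap).congr_ae_eventually (fun n => ?_) ?_
  · exact (((measurable_closedFormEstimator hF n).comp_aemeasurable hXm).sub_const θ).const_smul
      (√(n : ℝ))
  filter_upwards [hgram] with ω hω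
  have hev : ∀ᶠ n in atTop, (sampleMean (gram F) n fun k => X k ω).det ≠ 0 :=
    (((continuous_id.matrix_det).tendsto _).comp hω).eventually_ne hdet.ne_zero
  filter_upwards [hev] with n hn
  rw [closedFormEstimator_sub hn.isUnit θ]
  -- For `n = 0` both sides are `0`, so no case distinction is needed.
  have hsqrt : √(n : ℝ) * (n : ℝ)⁻¹ = (√(n : ℝ))⁻¹ := by
    rw [← div_eq_mul_inv, Real.sqrt_div_self]
  have hcoe : √(n : ℝ) • sampleMean (scoreVec F θ) n (fun k => X k ω) =
      (√(n : ℝ))⁻¹ • ∑ k ∈ Finset.range n, scoreVec F θ (X k ω) := by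
    rw [sampleMean, smul_smul, hsqrt]
  rw [← hcoe, WithLp.ofLp_smul, Matrix.mulVec_smul, ← smul_neg, WithLp.toLp_smul]
  rfl

/-- The closed-form estimator is consistent and eventually a critical point of a strictly convex
loss, so that once it has entered a neighbourhood `Θ` of `θ` it is the unique minimizer. -/
theorem eventually_eq_closedFormEstimator (hF : ContDiff ℝ 2 F)
    {Θ : Set (EuclideanSpace ℝ (Fin m))} (hΘ : Θ ⊆ naturalParameters F) (hθ : θ ∈ interior Θ)
    (hdet : IsUnit (expMatrix (gram F) P).det)
    (hmean : ∫ x, scoreVec F θ x ∂P = 0)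
    (hJ : ∀ i j, MemLp (fun x => jacobian F x i j) 2 P)
    (hS : Integrable (scoreVec F θ) P)
    (hlaw : ∀ k, HasLaw (X k) P μ) (hindep : iIndepFun X μ)
    {θhat : ℕ → Ω → EuclideanSpace ℝ (Fin m)}
    (hmin : ∀ n, ∀ᵐ ω ∂μ, (∃ t, IsLossMinimizer F Θ n (fun k => X k ω) t) →
      IsLossMinimizer F Θ n (fun k => X k ω) (θhat n ω)) :
    ∀ᵐ ω ∂μ, ∀ᶠ n in atTop, closedFormEstimator F n (fun k => X k ω) = θhat n ω := by
  have hscore := tendsto_sampleMean_ae hlaw hindep (continuous_scoreVec hF θ).measurable hS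
  rw [hmean] at hscore
  filter_upwards [tendsto_sampleMean_gram_ae hF hJ hlaw hindep, hscore, ae_all_iff.2 hmin]
    with ω hω hsω hminω
  have hev : ∀ᶠ n in atTop, (sampleMean (gram F) n fun k => X k ω).det ≠ 0 :=
    (((continuous_id.matrix_det).tendsto _).comp hω).eventually_ne hdet.ne_zero
  have hcons : Tendsto (fun n => closedFormEstimator F n fun k => X k ω) atTop (𝓝 θ) := by
    have hcont : Continuous fun p : Matrix (Fin m) (Fin m) ℝ × EuclideanSpace ℝ (Fin m) =>
        (WithLp.toLp 2 (-(p.1 *ᵥ (p.2 : Fin m → ℝ))) : EuclideanSpace ℝ (Fin m)) :=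
      (PiLp.continuous_toLp 2 _).comp (continuous_fst.matrix_mulVec
        ((PiLp.continuous_ofLp 2 _).comp continuous_snd)).neg
    have h1 := (hcont.tendsto (_, 0)).comp ((tendsto_inv_of_tendsto hω hdet).prodMk_nhds hsω)
    have h2 : Tendsto (fun n => closedFormEstimator F n (fun k => X k ω) - θ) atTop (𝓝 0) := by
      simp only [WithLp.ofLp_zero, Matrix.mulVec_zero, neg_zero, WithLp.toLp_zero] at h1
      refine h1.congr' ?_
      filter_upwards [hev] with n hn
      exact (closedFormEstimator_sub hn.isUnit θ).symm
    simpa using h2.add_const θ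
  filter_upwards [hev, hcons.eventually (mem_interior_iff_mem_nhds.1 hθ)] with n hn hmem
  obtain ⟨h1, h2⟩ := isLossMinimizer_closedFormEstimator hF hΘ hn.isUnit hmem
  exact (h2 _ (hminω n ⟨_, h1⟩)).symm

end Asymptotics

end ScoreMatching

theorem mainTheorem5 {d m : ℕ}
    (F : EuclideanSpace ℝ (Fin d) → EuclideanSpace ℝ (Fin m)) (hF : ContDiff ℝ 2 F)
    (Θ : Set (EuclideanSpace ℝ (Fin m))) (hΘ : Θ ⊆ ScoreMatching.naturalParameters F)
    (θ : EuclideanSpace ℝ (Fin m)) (hθ : θ ∈ Θ)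
    -- the density determines the parameter
    (hid : ∀ θ' ∈ ScoreMatching.naturalParameters F,
      ScoreMatching.density F θ' = ScoreMatching.density F θ → θ' = θ)
    -- decay: `E ‖JF‖² < ∞` and `E ‖JF JFᵀ θ + ΔF‖² < ∞`
    (hJ : ∀ i j, MemLp (fun x => ScoreMatching.jacobian F x i j) 2 (ScoreMatching.dist F θ))
    (hS : MemLp (ScoreMatching.scoreVec F θ) 2 (ScoreMatching.dist F θ))
    -- i.i.d. samples from `p_θ`
    {Ω : Type*} [MeasurableSpace Ω] (μ : Measure Ω) [IsProbabilityMeasure μ]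
    (X : ℕ → Ω → EuclideanSpace ℝ (Fin d))
    (hlaw : ∀ k, HasLaw (X k) (ScoreMatching.dist F θ) μ) (hindep : iIndepFun X μ) :
    IsUnit (ScoreMatching.expMatrix (ScoreMatching.gram F) (ScoreMatching.dist F θ)).det ∧
    (ScoreMatching.asympCov F θ).PosSemidef ∧
    -- the closed-form estimator
    TendstoInDistribution
      (fun (n : ℕ) ω =>
        √(n : ℝ) • (ScoreMatching.closedFormEstimator F n (fun k => X k ω) - θ))
      atTop id (fun _ => μ) (multivariateGaussian 0 (ScoreMatching.asympCov F θ)) ∧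
    -- every estimator that minimizes the empirical loss over `Θ` whenever a minimizer exists
    (θ ∈ interior Θ → ∀ θhat : ℕ → Ω → EuclideanSpace ℝ (Fin m),
      (∀ n, AEMeasurable (θhat n) μ) →
      (∀ n, ∀ᵐ ω ∂μ, (∃ t, ScoreMatching.IsLossMinimizer F Θ n (fun k => X k ω) t) →
        ScoreMatching.IsLossMinimizer F Θ n (fun k => X k ω) (θhat n ω)) →
      TendstoInDistribution (fun (n : ℕ) ω => √(n : ℝ) • (θhat n ω - θ))
        atTop id (fun _ => μ) (multivariateGaussian 0 (ScoreMatching.asympCov F θ))) := by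
  have hnat := hΘ hθ
  have := ScoreMatching.isProbabilityMeasure_dist hnat
  have hSint := hS.integrable (by norm_num)
  have hdet : IsUnit
      (ScoreMatching.expMatrix (ScoreMatching.gram F) (ScoreMatching.dist F θ)).det :=
    (ScoreMatching.posDef_expMatrix_gram hF hnat hid hJ).det_pos.ne'.isUnit
  have hmean := ScoreMatching.integral_scoreVec_eq_zero hF hnat
    (fun i j => (hJ i j).integrable (by norm_num)) hSint
  have hclosed := ScoreMatching.tendstoInDistribution_closedFormEstimator hF hdet hmean hJ hS
    hlaw hindep
  refine ⟨hdet, ScoreMatching.posSemidef_asympCov hS, hclosed, fun hint θhat hm hmin => ?_⟩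
  refine hclosed.congr_ae_eventually
    (fun n => ((hm n).sub_const θ).const_smul (√(n : ℝ))) ?_
  filter_upwards [ScoreMatching.eventually_eq_closedFormEstimator hF hΘ hint hdet hmean hJ hSint
    hlaw hindep hmin] with ω hω
  filter_upwards [hω] with n hn
  rw [hn]
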